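/- Let $p$ be a prime, let $r\ge 0$ be an integer, let $k$ be a field of characteristic $p$, and let $G=C_{p^r}$ be a cyclic group of order $p^r$. A $kG$-linear map $f\colon M\to N$ of $kG$-modules is called \emph{stably trivial} if it factors through a projective $kG$-module (that is, if it is zero in the stable module category), and it is called a \emph{ghost} if the induced map on Tate cohomology $\widehat H^{n}(G,M)\to\widehat H^{n}(G,N)$ is zero for every integer $n$. The \emph{ghost number} of $kG$ is the smallest non-negative integer $l$ such that every composite of $l$ ghosts between finite-dimensional $kG$-modules is stably trivial (a composite of $0$ ghosts being an identity map). Then the ghost number of $kC_{p^r}$ exists and equals $\lceil (p^r-1)/2\rceil$. -/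

import Mathlib

universe u

open CategoryTheory

namespace GhostNumber

/-- A homomorphism of `kG`-modules is trivial in the stable module category if it factors through
a projective `kG`-module. -/
def IsStablyTrivial {k G : Type u} [Field k] [Group G] {M N : Rep.{u} k G} (f : M ⟶ N) : Prop :=
  ∃ (P : Rep.{u} k G) (i : M ⟶ P) (q : P ⟶ N), Projective P ∧ i ≫ q = f

/-- A ghost is a homomorphism of `kG`-modules inducing the zero map on Tate cohomology
`Ĥ^n(G, -)` for every integer `n`. -/
def IsGhost {k G : Type u} [Field k] [Group G] [Fintype G] {M N : Rep.{u} k G} (f : M ⟶ N) :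
    Prop :=
  ∀ n : ℤ, (tateCohomologyFunctor n).map f = 0

/-- `IsGhostComposite l f` : the map `f` is a composite of `l` ghosts between finite-dimensional
`kG`-modules (all the intermediate modules being finite-dimensional). The composites of `0` ghosts
are the identity maps. -/
inductive IsGhostComposite {k G : Type u} [Field k] [Group G] [Fintype G] :
    ℕ → ∀ {M N : Rep.{u} k G}, (M ⟶ N) → Prop
  | id (M : Rep.{u} k G) (hM : Module.Finite k M) : IsGhostComposite 0 (𝟙 M)
  | comp {l : ℕ} {M N L : Rep.{u} k G} (f : M ⟶ N) (g : N ⟶ L) (hL : Module.Finite k L)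
      (hf : IsGhostComposite l f) (hg : IsGhost g) : IsGhostComposite (l + 1) (f ≫ g)

/-- `n` is the ghost number of `kG`: the smallest non-negative integer `l` such that every composite
of `l` ghosts between finite-dimensional `kG`-modules is stably trivial. In particular, such an
integer exists. -/
def IsGhostNumber (k G : Type u) [Field k] [Group G] [Fintype G] (n : ℕ) : Prop :=
  IsLeast {l : ℕ | ∀ (M N : Rep.{u} k G) (f : M ⟶ N), IsGhostComposite l f → IsStablyTrivial f} n

end GhostNumber

/-! Put `q = p ^ r` and `x = g - 1` for a generator `g`. In characteristic `p`, `x ^ q = 0` and the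
norm is `x ^ (q - 1)`, so modules are sums of Jordan blocks of length at most `q`. A map from a
finite-dimensional module is stably trivial iff it sends `ker x ^ i` into `im x ^ (q - i)` for all
`i` (`IsStablyTrivial.exists_subOne_pow`, `isStablyTrivial_of_forall_exists`).

Upper bound: a ghost sends `ker x` into `im x ^ (q - 1)` (degree 0) and `ker x ^ (q - 1)` into `im
x` (degree -1). Iterating `l` times, the first gives the criterion for `i ≤ l`
(`IsGhostComposite.exists_add`), the second for `i ≥ q - l`
(`IsGhostComposite.exists_subOne_pow_eq_of_le`). With `l = q / 2` every `i` is covered.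

Lower bound: `x` itself is a ghost on every module (`isGhost_applyAsHom_sub_id`), and on the Jordan
block of length `q / 2` no power `x ^ l` with `l < q / 2` is stably trivial. -/

namespace GhostNumber

/-! ### Nilpotent endomorphisms and Jordan blocks. -/

section LinearAlgebra

open Polynomial

lemma pow_apply_add {k V : Type*} [Semiring k] [AddCommMonoid V] [Module k V] (x : Module.End k V)
    (i j : ℕ) (v : V) : (x ^ (i + j)) v = (x ^ i) ((x ^ j) v) := by
  rw [pow_add, Module.End.mul_apply]

lemma pow_apply_eq_zero_of_le {k V : Type*} [Semiring k] [AddCommMonoid V] [Module k V]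
    {x : Module.End k V} {i j : ℕ} (hij : i ≤ j) {v : V} (hv : (x ^ i) v = 0) :
    (x ^ j) v = 0 := by
  obtain ⟨a, rfl⟩ := Nat.exists_eq_add_of_le' hij
  rw [pow_apply_add, hv, map_zero]

/-- If `ker x ⊆ im x ^ (q - 1)`, then `ker x ^ i ⊆ im x ^ (q - i)` for all `i`. -/
lemma exists_pow_sub_apply_eq {k V : Type*} [Ring k] [AddCommGroup V] [Module k V]
    (x : Module.End k V) (q : ℕ) (h : ∀ v, x v = 0 → ∃ w, (x ^ (q - 1)) w = v) (i : ℕ) :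
    ∀ v, (x ^ i) v = 0 → ∃ w, (x ^ (q - i)) w = v := by
  induction i with
  | zero => exact fun v hv ↦ ⟨0, by simpa using hv.symm⟩
  | succ i ih =>
    intro v hv
    by_cases hi : q ≤ i
    · exact ⟨v, by simp [Nat.sub_eq_zero_of_le (Nat.le_succ_of_le hi)]⟩
    obtain ⟨w, hw⟩ := h ((x ^ i) v) (by simpa [pow_succ'] using hv)
    obtain ⟨c, rfl⟩ : ∃ c, q = i + c + 1 := ⟨q - i - 1, by omega⟩
    -- Here `c = q - 1 - i`, so `x ^ i` kills `v - x ^ c w`, which is therefore some `x ^ (c + 1)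
    -- t`; thus `v = x ^ c (w + x t)`.
    obtain ⟨t, ht⟩ := ih (v - (x ^ c) w) (by
      rw [map_sub, ← pow_apply_add, ← hw, Nat.add_sub_cancel, sub_self])
    refine ⟨w + x t, ?_⟩
    rw [show i + c + 1 - i = c + 1 by omega, pow_succ, Module.End.mul_apply] at ht
    rw [show i + c + 1 - (i + 1) = c by omega, map_add, ht, add_sub_cancel]

/-- A nilpotent endomorphism of a finite-dimensional vector space has a Jordan decomposition, stated
as a universal property: `V` is freely generated by vectors `m j` subject to the relations
`x ^ (e j) • m j = 0`. -/
lemma exists_jordan_generators {k V : Type*} [Field k] [AddCommGroup V] [Module k V]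
    [Module.Finite k V] (x : Module.End k V) (hx : IsNilpotent x) :
    ∃ (d : ℕ) (e : Fin d → ℕ) (m : Fin d → V), (∀ j, (x ^ e j) (m j) = 0) ∧
      (∀ (W : Type _) [AddCommGroup W] [Module k W] (y : Module.End k W) (w : Fin d → W),
        (∀ j, (y ^ e j) (w j) = 0) →
        ∃ φ : V →ₗ[k] W, φ ∘ₗ x = y ∘ₗ φ ∧ ∀ j, φ (m j) = w j) ∧
      (∀ (W : Type _) [AddCommGroup W] [Module k W] (y : Module.End k W) (φ ψ : V →ₗ[k] W),
        φ ∘ₗ x = y ∘ₗ φ → ψ ∘ₗ x = y ∘ₗ ψ → (∀ j, φ (m j) = ψ (m j)) → φ = ψ) := by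
  classical
  obtain ⟨q, hq⟩ := hx
  -- Let `X` act as `x`: the structure theorem over the PID `k[X]` gives a sum of quotients `k[X] /
  -- (X ^ e j)`.
  have htors : Module.IsTorsion' (Module.AEval' x) (Submonoid.powers (X : k[X])) := by
    intro v
    refine ⟨⟨X ^ q, q, rfl⟩, ?_⟩
    obtain ⟨v, rfl⟩ := (Module.AEval'.of x).surjective v
    change (X ^ q : k[X]) • Module.AEval'.of x v = 0
    rw [Module.AEval'.X_pow_smul_of, hq, zero_smul, map_zero]
  obtain ⟨d, e, ⟨Φ⟩⟩ := Module.torsion_by_prime_power_decomposition (irreducible_X (R := k)) htors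
  let ι (j : Fin d) := DirectSum.lof k[X] (Fin d) (fun j ↦ k[X] ⧸ Submodule.span k[X] {(X : k[X]) ^ e j}) j
  let m (j : Fin d) : V := (Module.AEval'.of x).symm (Φ.symm (ι j (Submodule.Quotient.mk 1)))
  have hm (j : Fin d) : Module.AEval'.of x (m j) = Φ.symm (ι j (Submodule.Quotient.mk 1)) := by
    simp [m]
  refine ⟨d, e, m, fun j ↦ ?_, fun W _ _ y w hw ↦ ?_, fun W _ _ y φ ψ hφ hψ h ↦ ?_⟩
  · apply (Module.AEval'.of x).injective
    rw [map_zero, ← Module.End.smul_def, ← Module.AEval'.X_pow_smul_of, hm, ← map_smul, ← map_smul, ← Submodule.Quotient.mk_smul,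
      (Submodule.Quotient.mk_eq_zero _).2, map_zero, map_zero]
    simp
  · let F : Module.AEval' x →ₗ[k[X]] Module.AEval' y :=
      (DirectSum.toModule k[X] (Fin d) _ fun j ↦ Submodule.liftQ _
        (LinearMap.toSpanSingleton k[X] _ (Module.AEval'.of y (w j))) (by
          rw [Submodule.span_singleton_le_iff_mem, LinearMap.mem_ker,
            LinearMap.toSpanSingleton_apply, Module.AEval'.X_pow_smul_of, Module.End.smul_def, hw, map_zero])) ∘ₗ
      Φ.toLinearMap
    refine ⟨(Module.AEval'.of y).symm.toLinearMap ∘ₗ (F.restrictScalars k) ∘ₗ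
      (Module.AEval'.of x).toLinearMap, ?_, fun j ↦ ?_⟩
    · ext v
      simp [← Module.AEval'.X_smul_of]
    · have hj : F (Module.AEval'.of x (m j)) = Module.AEval'.of y (w j) := by
        simp only [F, hm, ι, LinearMap.comp_apply, LinearEquiv.coe_coe, LinearEquiv.apply_symm_apply,
          DirectSum.toModule_lof, Submodule.liftQ_apply, LinearMap.toSpanSingleton_apply, one_smul]
      simp [hj]
  · have key (θ : V →ₗ[k] W) (hθ : θ ∘ₗ x = y ∘ₗ θ) : ∃ Θ : Module.AEval' x →ₗ[k[X]] Module.AEval' y,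
        ∀ v, Θ (Module.AEval'.of x v) = Module.AEval'.of y (θ v) := by
      refine ⟨LinearMap.ofAEval x ((Module.AEval'.of y).toLinearMap ∘ₗ θ) fun v ↦ ?_, fun v ↦ rfl⟩
      have := LinearMap.congr_fun hθ v
      simp only [LinearMap.comp_apply] at this
      simp [Module.AEval'.X_smul_of, this]
    obtain ⟨Θ₁, h₁⟩ := key φ hφ
    obtain ⟨Θ₂, h₂⟩ := key ψ hψ
    have : Θ₁ ∘ₗ Φ.symm.toLinearMap = Θ₂ ∘ₗ Φ.symm.toLinearMap := by
      apply DirectSum.linearMap_ext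
      intro j
      apply Submodule.linearMap_qext
      ext
      have : Θ₁ (Φ.symm (ι j (Submodule.Quotient.mk 1))) =
          Θ₂ (Φ.symm (ι j (Submodule.Quotient.mk 1))) := by
        rw [← hm, h₁, h₂, h]
      simpa [ι] using this
    ext v
    apply (Module.AEval'.of y).injective
    rw [← h₁, ← h₂]
    simpa using LinearMap.congr_fun this (Φ (Module.AEval'.of x v))

end LinearAlgebra

/-! ### Free modules as function spaces. -/

section RegularRepresentation

/-- The representation of `G` on the functions `G → V` by right translation, where `V` is a vector
space: it is both induced and coinduced from the trivial group. -/
def translation (k G V : Type*) [CommSemiring k] [Group G] [AddCommMonoid V] [Module k V] :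
    Representation k G (G → V) where
  toFun g := LinearMap.funLeft k V (· * g)
  map_one' := by ext; simp [LinearMap.funLeft_apply]
  map_mul' g h := by ext; simp [LinearMap.funLeft_apply, mul_assoc]

@[simp]
lemma translation_apply (k G V : Type*) [CommSemiring k] [Group G] [AddCommMonoid V] [Module k V]
    (g : G) (v : G → V) (a : G) : translation k G V g v a = v (a * g) := rfl

variable {k G : Type u} [Field k] [Group G]

/-- The orbit map `m ↦ (g ↦ g m)` embedding a representation in a translation representation. -/
def toTranslation (M : Rep.{u} k G) : M ⟶ Rep.of (translation k G M) :=
  Rep.ofHom ⟨LinearMap.pi fun g ↦ M.ρ g, fun g ↦ by ext; simp⟩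

instance (M : Rep.{u} k G) : Mono (toTranslation M) := by
  rw [Rep.mono_iff_injective]
  intro m n h
  have h1 : M.ρ 1 m = M.ρ 1 n := congr_fun h 1
  simpa using h1

variable [Fintype G]

/-- The morphism of representations out of a translation representation induced by a linear map. -/
def ofTranslation {V : Type u} [AddCommGroup V] [Module k V] (N : Rep.{u} k G) (θ : V →ₗ[k] N) :
    Rep.of (translation k G V) ⟶ N :=
  Rep.ofHom ⟨∑ h : G, N.ρ h⁻¹ ∘ₗ θ ∘ₗ LinearMap.proj h, fun g ↦ by
    ext v : 1
    simp only [LinearMap.comp_apply, LinearMap.sum_apply, map_sum]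
    exact Fintype.sum_equiv (Equiv.mulRight g) _ _ fun h ↦ by
      simp [← Module.End.mul_apply, ← map_mul]⟩

lemma ofTranslation_apply {V : Type u} [AddCommGroup V] [Module k V] (N : Rep.{u} k G)
    (θ : V →ₗ[k] N) (v : G → V) : (ofTranslation N θ).hom v = ∑ h : G, N.ρ h⁻¹ (θ (v h)) := by
  change (∑ h : G, N.ρ h⁻¹ ∘ₗ θ ∘ₗ LinearMap.proj h : (G → V) →ₗ[k] N) v = _
  simp

lemma ofTranslation_single_one [DecidableEq G] {V : Type u} [AddCommGroup V] [Module k V]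
    (N : Rep.{u} k G) (θ : V →ₗ[k] N) (v : V) :
    (ofTranslation N θ).hom (Pi.single 1 v) = θ v := by
  rw [ofTranslation_apply, Finset.sum_eq_single 1] <;> simp +contextual

/-- Functions supported at `1` generate, so a morphism out of `translation k G V` is determined by
its restriction to them. -/
lemma sum_translation_single [DecidableEq G] {V : Type u} [AddCommGroup V] [Module k V]
    (v : G → V) : ∑ h : G, translation k G V h⁻¹ (Pi.single 1 (v h)) = v := by
  ext a
  rw [Finset.sum_apply, Finset.sum_eq_single a]
  · simp
  · intro b _ hb
    rw [translation_apply, Pi.single_eq_of_ne]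
    rwa [ne_eq, mul_inv_eq_one, eq_comm]
  · simp

instance projective_translation (V : Type u) [AddCommGroup V] [Module k V] :
    Projective (Rep.of (translation k G V)) where
  factors {E X} f e he := by
    classical
    obtain ⟨s, hs⟩ := e.hom.toLinearMap.exists_rightInverse_of_surjective
      (LinearMap.range_eq_top.2 ((Rep.epi_iff_surjective e).1 he))
    refine ⟨ofTranslation E (s ∘ₗ f.hom.toLinearMap ∘ₗ LinearMap.single k (fun _ : G ↦ V) 1), ?_⟩
    refine Rep.hom_ext (DFunLike.ext _ _ fun (v : G → V) ↦ ?_)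
    have hs' (y : X) : e.hom (s y) = y := LinearMap.congr_fun hs y
    have hv : f.hom v = f.hom (∑ h : G, translation k G V h⁻¹ (Pi.single 1 (v h))) :=
      congr_arg f.hom (sum_translation_single v).symm
    change e.hom ((ofTranslation E _).hom v) = f.hom v
    rw [hv, ofTranslation_apply, map_sum, map_sum]
    refine Finset.sum_congr rfl fun h _ ↦ ?_
    rw [Rep.hom_comm_apply]
    erw [hs', ← Rep.hom_comm_apply f]
    rfl

lemma ofTranslation_id_surjective (M : Rep.{u} k G) :
    Function.Surjective (ofTranslation M LinearMap.id).hom := by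
  classical
  exact fun m ↦ ⟨Pi.single 1 m, ofTranslation_single_one M _ m⟩

instance (M : Rep.{u} k G) : Epi (ofTranslation M LinearMap.id) :=
  (Rep.epi_iff_surjective _).2 (ofTranslation_id_surjective M)

lemma norm_translation_apply {V : Type u} [AddCommGroup V] [Module k V] (v : G → V) (a : G) :
    (translation k G V).norm v a = ∑ h, v h := by
  rw [Representation.norm, LinearMap.sum_apply, Finset.sum_apply]
  exact Fintype.sum_equiv (Equiv.mulLeft a) _ _ fun h ↦ by simp

end RegularRepresentation

/-! ### The operator `g - 1` in characteristic `p`. -/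

section Cyclic

/-- `g - 1` acting on a representation. -/
def subOne {k G V : Type*} [CommRing k] [Group G] [AddCommGroup V] [Module k V]
    (ρ : Representation k G V) (g : G) : Module.End k V := ρ g - 1

variable {k G : Type*} [Field k] [Group G] {V : Type*} [AddCommGroup V] [Module k V]
    (ρ : Representation k G V) {g : G}

lemma subOne_apply (g : G) (v : V) : subOne ρ g v = ρ g v - v := rfl

lemma apply_eq_of_forall_mem_zpowers [Finite G] (hg : ∀ x, x ∈ Subgroup.zpowers g) {v : V}
    (hv : subOne ρ g v = 0) (h : G) : ρ h v = v := by
  rw [subOne_apply, sub_eq_zero] at hv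
  obtain ⟨i, rfl⟩ := mem_powers_iff_mem_zpowers.2 (hg h)
  induction i with
  | zero => simp
  | succ i ih => simpa [pow_succ, hv] using ih

lemma subOne_pow_prime_pow [Finite G] {p r : ℕ} (hp : p.Prime) [CharP k p]
    (hG : Nat.card G = p ^ r) : subOne ρ g ^ p ^ r = 0 := by
  have := Fact.mk hp
  have h : ((Polynomial.X : Polynomial k) - 1) ^ p ^ r = Polynomial.X ^ p ^ r - 1 := by
    rw [sub_pow_char_pow, one_pow]
  have := congr(Polynomial.aeval (ρ g) $h)
  simp only [map_sub, map_pow, Polynomial.aeval_X, map_one] at this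
  rw [subOne, this, ← map_pow, ← hG, pow_card_eq_one', map_one, sub_self]

/-- In `k[X]`, both `∑ X ^ i` and `(X - 1) ^ (q - 1)` give `X ^ q - 1` when multiplied by `X - 1`;
cancel and evaluate at `ρ g`. -/
lemma norm_eq_subOne_pow [Fintype G] (hg : ∀ x, x ∈ Subgroup.zpowers g) {p r : ℕ} (hp : p.Prime)
    [CharP k p] (hG : Nat.card G = p ^ r) : ρ.norm = subOne ρ g ^ (p ^ r - 1) := by
  classical
  have := Fact.mk hp
  have h : ∑ i ∈ Finset.range (p ^ r), (Polynomial.X : Polynomial k) ^ i =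
      (Polynomial.X - 1) ^ (p ^ r - 1) := by
    have h1 : (Polynomial.X - 1 : Polynomial k) ≠ 0 := by
      simpa using Polynomial.X_sub_C_ne_zero (1 : k)
    apply mul_right_cancel₀ h1
    rw [geom_sum_mul, ← pow_succ, Nat.sub_add_cancel (Nat.pow_pos hp.pos), sub_pow_char_pow,
      one_pow]
  have h := congr(Polynomial.aeval (ρ g) $h)
  simp only [map_sum, map_pow, map_sub, Polynomial.aeval_X, map_one] at h
  rw [subOne, ← h, Representation.norm, ← hG, ← orderOf_eq_card_of_forall_mem_zpowers hg,
    ← IsCyclic.image_range_orderOf hg, Finset.sum_image fun i hi j hj h ↦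
      pow_injOn_Iio_orderOf (by simpa using hi) (by simpa using hj) h]
  simp

lemma mem_range_norm_translation {k G V : Type u} [Field k] [Group G] [Fintype G]
    [AddCommGroup V] [Module k V] {g : G} (hg : ∀ x, x ∈ Subgroup.zpowers g) (v : G → V)
    (hv : subOne (translation k G V) g v = 0) : ∃ w, (translation k G V).norm w = v := by
  classical
  -- An invariant function is constant, and the norm spreads a value at `1` over all of `G`.
  refine ⟨Pi.single 1 (v 1), ?_⟩
  ext a
  have := congr_fun (apply_eq_of_forall_mem_zpowers _ hg hv a) 1
  rw [norm_translation_apply, Finset.sum_pi_single']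
  simpa using this.symm

lemma exists_subOne_pow_translation {k G V : Type u} [Field k] [Group G] [Fintype G]
    [AddCommGroup V] [Module k V] {g : G} (hg : ∀ x, x ∈ Subgroup.zpowers g) {p r : ℕ}
    (hp : p.Prime) [CharP k p] (hG : Nat.card G = p ^ r) (i : ℕ) (v : G → V)
    (hv : (subOne (translation k G V) g ^ i) v = 0) :
    ∃ w, (subOne (translation k G V) g ^ (p ^ r - i)) w = v := by
  refine exists_pow_sub_apply_eq _ _ (fun v hv ↦ ?_) i v hv
  rw [← norm_eq_subOne_pow _ hg hp hG]
  exact mem_range_norm_translation hg v hv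

end Cyclic

/-! ### Criterion for stable triviality. -/

section StablyTrivial

lemma hom_subOne {k G : Type u} [Field k] [Group G] {M N : Rep.{u} k G} (f : M ⟶ N) (g : G)
    (m : M) : f.hom (subOne M.ρ g m) = subOne N.ρ g (f.hom m) := by
  simp [subOne_apply, Rep.hom_comm_apply]

lemma hom_subOne_pow {k G : Type u} [Field k] [Group G] {M N : Rep.{u} k G} (f : M ⟶ N) (g : G)
    (i : ℕ) (m : M) : f.hom ((subOne M.ρ g ^ i) m) = (subOne N.ρ g ^ i) (f.hom m) := by
  induction i generalizing m with
  | zero => simp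
  | succ i ih => rw [pow_succ, Module.End.mul_apply, ih, hom_subOne, pow_succ, Module.End.mul_apply]

variable {k G : Type u} [Field k] [Group G] [Fintype G] {g : G}
  (hg : ∀ x, x ∈ Subgroup.zpowers g) {p r : ℕ} (hp : p.Prime) [CharP k p]
  (hG : Nat.card G = p ^ r) {M N : Rep.{u} k G} (f : M ⟶ N)

include hg in
/-- A linear map commuting with the generator of a cyclic group is a morphism of representations. -/
lemma exists_hom_of_comp_subOne (φ : M →ₗ[k] N) (hφ : φ ∘ₗ subOne M.ρ g = subOne N.ρ g ∘ₗ φ) :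
    ∃ F : M ⟶ N, ∀ m, F.hom m = φ m := by
  have h1 (m : M) : φ (M.ρ g m) = N.ρ g (φ m) := by
    simpa [subOne_apply] using LinearMap.congr_fun hφ m
  refine ⟨Rep.ofHom (LinearMap.intertwiningMap_of_isIntertwiningMap _ _ φ fun h m ↦ ?_), fun m ↦ rfl⟩
  obtain ⟨i, rfl⟩ := mem_powers_iff_mem_zpowers.2 (hg h)
  induction i generalizing m with
  | zero => simp
  | succ i ih => simp only [pow_succ, map_mul, Module.End.mul_apply] at ih ⊢; rw [ih, h1]

include hg hp hG in
-- A projective is a retract of a translation representation, where `ker x ^ i ⊆ im x ^ (q - i)`.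
lemma IsStablyTrivial.exists_subOne_pow {f : M ⟶ N} (hf : IsStablyTrivial f) (i : ℕ) (m : M)
    (hm : (subOne M.ρ g ^ i) m = 0) : ∃ n, (subOne N.ρ g ^ (p ^ r - i)) n = f.hom m := by
  obtain ⟨P, a, b, hP, rfl⟩ := hf
  let s : P ⟶ Rep.of (translation k G P) := Projective.factorThru (𝟙 P) (ofTranslation P LinearMap.id)
  have hs : s ≫ ofTranslation P LinearMap.id = 𝟙 P := Projective.factorThru_comp _ _
  obtain ⟨w, hw⟩ := exists_subOne_pow_translation hg hp hG i (s.hom (a.hom m)) (by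
    have := hom_subOne_pow (a ≫ s) g i m
    rw [hm, map_zero] at this
    exact this.symm)
  refine ⟨b.hom ((ofTranslation P LinearMap.id).hom w), ?_⟩
  rw [← hom_subOne_pow, ← hom_subOne_pow (ofTranslation P LinearMap.id)]
  change b.hom ((ofTranslation P LinearMap.id).hom ((subOne (translation k G P) g ^ (p ^ r - i)) w)) = _
  rw [hw]
  exact congr_arg b.hom (congr(($hs).hom (a.hom m)))

include hg hp hG in
lemma isStablyTrivial_of_forall_exists [Module.Finite k M] {f : M ⟶ N}
    (hf : ∀ (i : ℕ) (m : M), (subOne M.ρ g ^ i) m = 0 →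
      ∃ n, (subOne N.ρ g ^ (p ^ r - i)) n = f.hom m) : IsStablyTrivial f := by
  classical
  obtain ⟨d, e, m, hm, hex, huniq⟩ := exists_jordan_generators (subOne M.ρ g)
    ⟨p ^ r, subOne_pow_prime_pow _ hp hG⟩
  choose n hn using fun j ↦ hf (e j) (m j) (hm j)
  let P : Rep.{u} k G := Rep.of (translation k G (Fin d → k))
  let b (j : Fin d) : P := Pi.single 1 (Pi.single j 1)
  -- Factor `f` through the free module on the `b j`: send `m j` to `x ^ (q - e j) (b j)`, then `b
  -- j` to `n j`. The relations hold because `x ^ q = 0`.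
  obtain ⟨φ, hφ, hφm⟩ := hex P (subOne P.ρ g) (fun j ↦ (subOne P.ρ g ^ (p ^ r - e j)) (b j)) fun j ↦ by
    rw [← pow_apply_add]
    refine pow_apply_eq_zero_of_le (i := p ^ r) (by omega) ?_
    rw [subOne_pow_prime_pow _ hp hG, LinearMap.zero_apply]
  obtain ⟨a, ha⟩ := exists_hom_of_comp_subOne hg φ hφ
  let c : P ⟶ N := ofTranslation N (Fintype.linearCombination k n)
  have hc (j : Fin d) : c.hom (b j) = n j := by
    simp only [c, b]
    erw [ofTranslation_single_one]
    simp
  refine ⟨P, a, c, inferInstance, ?_⟩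
  ext v
  refine LinearMap.congr_fun (huniq N (subOne N.ρ g) (a ≫ c).hom.toLinearMap f.hom.toLinearMap
    (LinearMap.ext fun v ↦ hom_subOne (a ≫ c) g v) (LinearMap.ext fun v ↦ hom_subOne f g v) fun j ↦ ?_) v
  change c.hom (a.hom (m j)) = f.hom (m j)
  rw [ha, hφm, hom_subOne_pow, hc, hn]

end StablyTrivial

/-! ### Homology in terms of elements. -/

section Homology

variable {k : Type u} [Field k] {C D : CochainComplex (ModuleCat.{u} k) ℤ} {i j l : ℤ}

lemma homologyMap_eq_zero_of_forall (φ : C ⟶ D) (l : ℤ)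
    (h : ∀ z, (C.d j l).hom z = 0 → (φ.f j).hom z = 0) :
    HomologicalComplex.homologyMap φ j = 0 := by
  rw [← cancel_epi (C.homologyπ j), HomologicalComplex.homologyπ_naturality, Limits.comp_zero]
  suffices HomologicalComplex.cyclesMap φ j = 0 by rw [this, Limits.zero_comp]
  rw [← cancel_mono (D.iCycles j), HomologicalComplex.cyclesMap_i, Limits.zero_comp]
  ext z
  refine h _ ?_
  exact congr(($(C.iCycles_d j l)).hom z)

lemma exists_d_eq_of_homologyMap_eq_zero {φ : C ⟶ D} (hij : i + 1 = j) (hjl : j + 1 = l)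
    (h : HomologicalComplex.homologyMap φ j = 0) (z : C.X j) (hz : (C.d j l).hom z = 0) :
    ∃ y, (D.d i j).hom y = (φ.f j).hom z := by
  have hi : (ComplexShape.up ℤ).prev j = i := by simp [← hij]
  have hl : (ComplexShape.up ℤ).next j = l := by simp [← hjl]
  -- The cycle `z` is encoded as a morphism from `k`.
  let ζ : ModuleCat.of k (ULift.{u} k) ⟶ C.X j :=
    ModuleCat.ofHom (LinearMap.toSpanSingleton k _ z ∘ₗ ULift.moduleEquiv.toLinearMap)
  have hζ : ζ ≫ C.d j l = 0 := by
    ext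
    simp [ζ, hz]
  have h0 : D.liftCycles (ζ ≫ φ.f j) l hl (by rw [Category.assoc, φ.comm, reassoc_of% hζ,
      Limits.zero_comp]) ≫ D.homologyπ j = 0 := by
    rw [← HomologicalComplex.liftCycles_comp_cyclesMap ζ l hl hζ φ, Category.assoc,
      ← HomologicalComplex.homologyπ_naturality, h, Limits.comp_zero, Limits.comp_zero]
  rw [HomologicalComplex.liftCycles_comp_homologyπ_eq_zero_iff_up_to_refinements _ i j l hi hl] at h0
  obtain ⟨A, π, hπ, x, hx⟩ := h0
  obtain ⟨a, ha⟩ := (ModuleCat.epi_iff_surjective π).1 hπ ⟨1⟩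
  refine ⟨x.hom a, ?_⟩
  have := congr(($hx).hom a)
  simp only [ModuleCat.hom_comp, LinearMap.comp_apply, ζ] at this
  rw [← this]
  erw [ha]
  simp

lemma isZero_homology_of_forall (hij : i + 1 = j) (hjl : j + 1 = l)
    (h : ∀ z, (C.d j l).hom z = 0 → ∃ y, (C.d i j).hom y = z) : Limits.IsZero (C.homology j) := by
  have hi : (ComplexShape.up ℤ).prev j = i := by simp [← hij]
  have hl : (ComplexShape.up ℤ).next j = l := by simp [← hjl]
  rw [← HomologicalComplex.exactAt_iff_isZero_homology, HomologicalComplex.exactAt_iff' _ i j l hi hl,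
    ShortComplex.moduleCat_exact_iff]
  exact h

end Homology

/-! ### Tate cohomology in degrees 0 and -1. -/

section Tate

variable {k G : Type u} [Field k] [Group G] [Fintype G] {M N : Rep.{u} k G}

open groupHomology groupCohomology

lemma tateComplex_d_neg_one_apply (m : M) :
    ((tateComplex M).d (-1) 0).hom ((chainsIso₀ M).inv.hom m) =
      (cochainsIso₀ M).inv.hom (M.ρ.norm m) := by
  have h : (chainsIso₀ M).inv ≫ M.tateNorm = M.norm.toModuleCatHom ≫ (cochainsIso₀ M).inv := by
    simp [Rep.tateNorm]
  exact congr(($h).hom m)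

lemma tateComplex_d_zero_apply_eq_zero_iff (m : M) :
    ((tateComplex M).d 0 1).hom ((cochainsIso₀ M).inv.hom m) = 0 ↔ ∀ g, M.ρ g m = m := by
  have h : ((tateComplex M).d 0 1).hom ((cochainsIso₀ M).inv.hom m) =
      (cochainsIso₁ M).inv.hom ((d₀₁ M).hom m) := congr(($(eq_d₀₁_comp_inv M)).hom m)
  have hinj : Function.Injective (cochainsIso₁ M).inv.hom :=
    (ModuleCat.mono_iff_injective _).1 inferInstance
  refine ((Eq.congr_left h).trans (map_eq_zero_iff _ hinj)).trans ?_
  refine funext_iff.trans (forall_congr' fun g ↦ ?_)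
  exact sub_eq_zero

lemma exists_tateComplex_d_neg_two_iff (m : M) :
    (∃ y, ((tateComplex M).d (-2) (-1)).hom y = (chainsIso₀ M).inv.hom m) ↔
      m ∈ Representation.Coinvariants.ker M.ρ := by
  rw [← range_d₁₀_eq_coinvariantsKer]
  have h := comp_d₁₀_eq M
  have h' := eq_d₁₀_comp_inv M
  constructor
  · rintro ⟨y, hy⟩
    refine ⟨(chainsIso₁ M).hom.hom y, ?_⟩
    have := congr(($h).hom y)
    refine this.trans ?_
    change (chainsIso₀ M).hom.hom (((tateComplex M).d (-2) (-1)).hom y) = m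
    rw [hy]
    exact congr(($((chainsIso₀ M).inv_hom_id)).hom m)
  · rintro ⟨y, rfl⟩
    exact ⟨(chainsIso₁ M).inv.hom y, congr(($h').hom y)⟩

lemma tateComplex_map_zero_apply (f : M ⟶ N) (m : M) :
    ((tateComplex.map f).f 0).hom ((cochainsIso₀ M).inv.hom m) =
      (cochainsIso₀ N).inv.hom (f.hom m) := by
  rfl

lemma tateComplex_map_neg_one_apply (f : M ⟶ N) (m : M) :
    ((tateComplex.map f).f (-1)).hom ((chainsIso₀ M).inv.hom m) =
      (chainsIso₀ N).inv.hom (f.hom m) := by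
  have h : (chainsIso₀ M).inv ≫ (chainsMap (.id G) f).f 0 =
      f.toModuleCatHom ≫ (chainsIso₀ N).inv := by
    rw [Iso.inv_comp_eq, ← Category.assoc, Iso.eq_comp_inv]
    exact chainsMap_f_0_comp_chainsIso₀ _ _
  exact congr(($h).hom m)

omit [Fintype G] in
lemma cochainsIso₀_inv_surjective : Function.Surjective (cochainsIso₀ M).inv.hom :=
  (ModuleCat.epi_iff_surjective _).1 inferInstance

omit [Fintype G] in
lemma cochainsIso₀_inv_injective : Function.Injective (cochainsIso₀ M).inv.hom :=
  (ModuleCat.mono_iff_injective _).1 inferInstance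

omit [Fintype G] in
lemma chainsIso₀_inv_surjective : Function.Surjective (chainsIso₀ M).inv.hom :=
  (ModuleCat.epi_iff_surjective _).1 inferInstance

lemma IsGhost.exists_norm_eq {f : M ⟶ N} (hf : IsGhost f) (m : M) (hm : ∀ g, M.ρ g m = m) :
    ∃ n, N.ρ.norm n = f.hom m := by
  obtain ⟨y, hy⟩ := exists_d_eq_of_homologyMap_eq_zero (φ := tateComplex.map f) (i := -1) (j := 0) (l := 1)
    rfl rfl (hf 0) _ ((tateComplex_d_zero_apply_eq_zero_iff m).2 hm)
  obtain ⟨n, rfl⟩ := chainsIso₀_inv_surjective (M := N) y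
  refine ⟨n, cochainsIso₀_inv_injective ?_⟩
  rw [← tateComplex_d_neg_one_apply, hy, tateComplex_map_zero_apply]

lemma IsGhost.mem_coinvariantsKer {f : M ⟶ N} (hf : IsGhost f) (m : M) (hm : M.ρ.norm m = 0) :
    f.hom m ∈ Representation.Coinvariants.ker N.ρ := by
  rw [← exists_tateComplex_d_neg_two_iff, ← tateComplex_map_neg_one_apply]
  refine exists_d_eq_of_homologyMap_eq_zero (φ := tateComplex.map f) (i := -2) (j := -1) (l := 0)
    rfl rfl (hf (-1)) _ ?_
  rw [tateComplex_d_neg_one_apply, hm, map_zero]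
  rfl

end Tate

/-! ### The operator `g - 1` is a ghost. -/

section GhostSubOne

open groupHomology groupCohomology Representation.FiniteCyclicGroup

variable {k G : Type u} [Field k] [CommGroup G] [Fintype G] {g : G}
  (hg : ∀ x, x ∈ Subgroup.zpowers g)

omit [Fintype G] in
lemma applyAsHom_sub_id_apply (M : Rep.{u} k G) (m : M) :
    (M.applyAsHom g - 𝟙 M).hom m = subOne M.ρ g m := rfl

include hg in
/-- The Tate cohomology of a representation of a cyclic group vanishes as soon as it vanishes in
degrees `0` and `-1`. -/
lemma isZero_tateCohomology (M : Rep.{u} k G)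
    (h0 : ∀ m : M, subOne M.ρ g m = 0 → ∃ n, M.ρ.norm n = m)
    (h1 : ∀ m : M, M.ρ.norm m = 0 → ∃ n, subOne M.ρ g n = m) (n : ℤ) :
    Limits.IsZero (tateCohomology M n) := by
  classical
  -- By periodicity these two homologies give all degrees other than 0 and -1, according to parity;
  -- 0 and -1 are treated on the Tate complex itself.
  have e0 : Limits.IsZero (Rep.FiniteCyclicGroup.normHomCompSub M g).homology := by
    rw [← ShortComplex.exact_iff_isZero_homology, ShortComplex.moduleCat_exact_iff]
    exact h0
  have e1 : Limits.IsZero (Rep.FiniteCyclicGroup.subCompNormHom M g).homology := by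
    rw [← ShortComplex.exact_iff_isZero_homology, ShortComplex.moduleCat_exact_iff]
    exact h1
  obtain ⟨n, rfl | rfl⟩ : ∃ m : ℕ, n = m ∨ n = -(m + 1) := by
    obtain h | h := le_or_gt 0 n
    · exact ⟨n.toNat, by omega⟩
    · exact ⟨(-n - 1).toNat, by omega⟩
  · obtain rfl | hn := eq_or_ne n 0
    · refine isZero_homology_of_forall (i := -1) (l := 1) rfl rfl fun z hz ↦ ?_
      obtain ⟨m, rfl⟩ := cochainsIso₀_inv_surjective (M := M) z
      have hm := (tateComplex_d_zero_apply_eq_zero_iff m).1 hz g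
      obtain ⟨y, rfl⟩ := h0 m (by rw [subOne_apply, hm, sub_self])
      exact ⟨_, tateComplex_d_neg_one_apply y⟩
    · have : NeZero n := ⟨hn⟩
      refine Limits.IsZero.of_iso ?_ ((TateCohomology.isoGroupCohomology n).app M)
      obtain h | h := Nat.even_or_odd n
      · exact e0.of_iso (Rep.FiniteCyclicGroup.groupCohomologyIsoEven M g hg n h)
      · exact e1.of_iso (Rep.FiniteCyclicGroup.groupCohomologyIsoOdd M g hg n h)
  · obtain rfl | hn := eq_or_ne n 0
    · refine isZero_homology_of_forall (C := tateComplex M) (i := -2) (l := 0) rfl rfl fun z hz ↦ ?_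
      obtain ⟨m, rfl⟩ := chainsIso₀_inv_surjective (M := M) z
      refine (exists_tateComplex_d_neg_two_iff m).2 ?_
      obtain ⟨y, rfl⟩ := h1 m (cochainsIso₀_inv_injective (by
        rw [map_zero, ← tateComplex_d_neg_one_apply]
        exact hz))
      exact Representation.Coinvariants.sub_mem_ker g y
    · have : NeZero n := ⟨hn⟩
      refine Limits.IsZero.of_iso ?_ ((TateCohomology.isoGroupHomology _ n rfl).app M)
      obtain h | h := Nat.even_or_odd n
      · exact e1.of_iso (Rep.FiniteCyclicGroup.groupHomologyIsoEven M g hg n h)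
      · exact e0.of_iso (Rep.FiniteCyclicGroup.groupHomologyIsoOdd M g hg n h)

/-- The endomorphism `g - 1` of a short exact sequence. -/
def applyAsHomSubId (S : ShortComplex (Rep.{u} k G)) (g : G) : S ⟶ S where
  τ₁ := S.X₁.applyAsHom g - 𝟙 _
  τ₂ := S.X₂.applyAsHom g - 𝟙 _
  τ₃ := S.X₃.applyAsHom g - 𝟙 _
  comm₁₂ := by simp [Rep.applyAsHom_comm]
  comm₂₃ := by simp [Rep.applyAsHom_comm]

/-- `g - 1` acts as zero on the Tate cohomology of every representation of a cyclic group, provided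
that the Tate cohomology of translation representations vanishes. -/
lemma isGhost_applyAsHom_sub_id
    (h : ∀ (M : Rep.{u} k G) (n : ℤ), Limits.IsZero (tateCohomology (Rep.of (translation k G M)) n))
    (M : Rep.{u} k G) : IsGhost (M.applyAsHom g - 𝟙 M) := by
  intro n
  induction n using Int.induction_on generalizing M with
  | zero =>
    refine homologyMap_eq_zero_of_forall (tateComplex.map _) 1 fun z hz ↦ ?_
    obtain ⟨m, rfl⟩ := cochainsIso₀_inv_surjective (M := M) z
    rw [tateComplex_map_zero_apply, applyAsHom_sub_id_apply, subOne_apply,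
      (tateComplex_d_zero_apply_eq_zero_iff m).1 hz g, sub_self, map_zero]
    rfl
  | succ i ih =>
    -- Dimension shifting: the middle term has no cohomology, so the connecting map onto
    -- `Ĥ^(i+1)(M)` is epi, and it commutes with `g - 1`.
    let S := ShortComplex.mk (toTranslation M) (Limits.cokernel.π (toTranslation M))
      (Limits.cokernel.condition _)
    have hS : S.ShortExact := ⟨ShortComplex.exact_of_g_is_cokernel _
      (Limits.cokernelIsCokernel (toTranslation M))⟩
    have hepi : Epi (TateCohomology.δ hS i) :=
      (TateCohomology.exact₁ hS i).epi_f ((h M _).eq_of_tgt _ _)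
    rw [← cancel_epi (TateCohomology.δ hS i), Limits.comp_zero]
    have := TateCohomology.δ_naturality hS hS (applyAsHomSubId S g) i
    refine this.trans ?_
    have := ih S.X₃
    simp only [applyAsHomSubId]
    rw [this, Limits.zero_comp]
  | pred i ih =>
    -- Dually, the connecting map out of the Tate cohomology of `M` is mono.
    let S := ShortComplex.mk (Limits.kernel.ι (ofTranslation M LinearMap.id))
      (ofTranslation M LinearMap.id) (Limits.kernel.condition _)
    have hS : S.ShortExact := ⟨ShortComplex.exact_of_f_is_kernel _
      (Limits.kernelIsKernel (ofTranslation M LinearMap.id))⟩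
    have hmono : Mono (TateCohomology.δ hS (-i - 1)) :=
      (TateCohomology.exact₃ hS (-i - 1)).mono_g ((h M _).eq_of_src _ _)
    rw [← cancel_mono (TateCohomology.δ hS (-i - 1)), Limits.zero_comp]
    have := TateCohomology.δ_naturality hS hS (applyAsHomSubId S g) (-i - 1)
    refine this.symm.trans ?_
    have := ih S.X₁
    rw [← sub_add_cancel (-i : ℤ) 1] at this
    simp only [applyAsHomSubId]
    rw [this, Limits.comp_zero]

end GhostSubOne

/-! ### Upper bound. -/

section Composites

variable {k G : Type u} [Field k] [Group G] [Fintype G] {g : G}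
  (hg : ∀ x, x ∈ Subgroup.zpowers g) {p r : ℕ} (hp : p.Prime) [CharP k p]
  (hG : Nat.card G = p ^ r)

include hg hp hG

lemma IsGhost.exists_subOne_pow_eq {M N : Rep.{u} k G} {f : M ⟶ N} (hf : IsGhost f) (m : M)
    (hm : subOne M.ρ g m = 0) : ∃ n, (subOne N.ρ g ^ (p ^ r - 1)) n = f.hom m := by
  rw [← norm_eq_subOne_pow _ hg hp hG]
  exact hf.exists_norm_eq m (apply_eq_of_forall_mem_zpowers _ hg hm)

lemma IsGhost.exists_subOne_eq {M N : Rep.{u} k G} {f : M ⟶ N} (hf : IsGhost f) (m : M)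
    (hm : (subOne M.ρ g ^ (p ^ r - 1)) m = 0) : ∃ n, subOne N.ρ g n = f.hom m := by
  rw [← norm_eq_subOne_pow _ hg hp hG] at hm
  have := hf.mem_coinvariantsKer m hm
  rwa [Representation.FiniteCyclicGroup.coinvariantsKer_eq_range _ _ hg] at this

/-- Each ghost lowers by one the exponent killing the error `n'`. If `x ^ (c + 1) n' = 0`, then `x ^
c n' ∈ ker x` maps to some `x ^ (q - 1) t`; moving `x ^ (q - 1 - c) t` into the main term leaves an
error killed by `x ^ c`. -/
lemma IsGhostComposite.exists_add {l : ℕ} {M N : Rep.{u} k G} {f : M ⟶ N}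
    (hf : IsGhostComposite l f) {i : ℕ} (hi : i ≤ p ^ r) (m : M) (hm : (subOne M.ρ g ^ i) m = 0) :
    ∃ n n', f.hom m = (subOne N.ρ g ^ (p ^ r - i)) n + n' ∧ (subOne N.ρ g ^ (i - l)) n' = 0 := by
  induction hf with
  | id M hM => exact ⟨0, m, by simp, by simpa using hm⟩
  | @comp l M N L f f' _ hf hf' ih =>
    obtain ⟨n, n', h, hn'⟩ := ih m hm
    have hm' : (f ≫ f').hom m = (subOne L.ρ g ^ (p ^ r - i)) (f'.hom n) + f'.hom n' := by
      change f'.hom (f.hom m) = _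
      rw [h, map_add, hom_subOne_pow]
    obtain hl | ⟨c, hc⟩ : i - l = 0 ∨ ∃ c, i - l = c + 1 := by
      cases i - l <;> simp
    · refine ⟨_, _, hm', pow_apply_eq_zero_of_le (i := 0) (Nat.zero_le _) ?_⟩
      rw [hl] at hn'
      simpa using congr_arg f'.hom hn'
    · rw [hc, pow_succ', Module.End.mul_apply] at hn'
      obtain ⟨t, ht⟩ := hf'.exists_subOne_pow_eq hg hp hG _ hn'
      refine ⟨f'.hom n + (subOne L.ρ g ^ l) t, f'.hom n' - (subOne L.ρ g ^ (p ^ r - i + l)) t, ?_, ?_⟩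
      · rw [hm', map_add, ← pow_apply_add]
        abel
      · rw [show i - (l + 1) = c by omega, map_sub, ← hom_subOne_pow, ← pow_apply_add, ← ht,
          show c + (p ^ r - i + l) = p ^ r - 1 by omega, sub_self]

/-- Each ghost gains a factor `x`: if `f m = x ^ j n` and `x ^ (q - j - 1) m = 0`, then `x ^ (q - 1)
n = 0`, so the next ghost sends `n` into `im x`. -/
lemma IsGhostComposite.exists_subOne_pow_eq_of_le {l : ℕ} {M N : Rep.{u} k G} {f : M ⟶ N}
    (hf : IsGhostComposite l f) {j : ℕ} (hj : j ≤ l) (m : M)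
    (hm : (subOne M.ρ g ^ (p ^ r - j)) m = 0) : ∃ n, (subOne N.ρ g ^ j) n = f.hom m := by
  induction hf generalizing j with
  | id M hM => exact ⟨m, by simp [Nat.le_zero.1 hj]⟩
  | @comp l M N L f f' _ hf hf' ih =>
    change ∃ n, (subOne L.ρ g ^ j) n = f'.hom (f.hom m)
    cases j with
    | zero => exact ⟨f'.hom (f.hom m), by simp⟩
    | succ j =>
      by_cases hq : p ^ r ≤ j
      · rw [Nat.sub_eq_zero_of_le (by omega), pow_zero, Module.End.one_apply] at hm
        exact ⟨0, by simp [hm]⟩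
      obtain ⟨n, hn⟩ := ih (j := j) (by omega) m (pow_apply_eq_zero_of_le (by omega) hm)
      obtain ⟨t, ht⟩ := hf'.exists_subOne_eq hg hp hG n (by
        have := hom_subOne_pow f g (p ^ r - (j + 1)) m
        rwa [hm, map_zero, ← hn, ← pow_apply_add, eq_comm,
          show p ^ r - (j + 1) + j = p ^ r - 1 by omega] at this)
      exact ⟨t, by rw [← hn, hom_subOne_pow, ← ht, pow_succ, Module.End.mul_apply]⟩

omit hg hp hG in
omit [CharP k p] in
lemma IsGhostComposite.finite {l : ℕ} {M N : Rep.{u} k G} {f : M ⟶ N}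
    (hf : IsGhostComposite l f) : Module.Finite k M := by
  induction hf with
  | id M hM => exact hM
  | comp _ _ _ _ _ ih => exact ih

lemma IsGhostComposite.isStablyTrivial {M N : Rep.{u} k G} {f : M ⟶ N}
    (hf : IsGhostComposite (p ^ r / 2) f) : IsStablyTrivial f := by
  have := hf.finite
  refine isStablyTrivial_of_forall_exists hg hp hG fun i m hm ↦ ?_
  obtain hi | hi := le_or_gt (p ^ r) i
  · exact ⟨f.hom m, by simp [Nat.sub_eq_zero_of_le hi]⟩
  obtain hl | hl := le_or_gt i (p ^ r / 2)
  · obtain ⟨n, n', h, hn'⟩ := hf.exists_add hg hp hG hi.le m hm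
    rw [Nat.sub_eq_zero_of_le hl, pow_zero, Module.End.one_apply] at hn'
    exact ⟨n, by rw [h, hn', add_zero]⟩
  · refine hf.exists_subOne_pow_eq_of_le hg hp hG (by omega) m ?_
    rwa [Nat.sub_sub_self hi.le]

end Composites

/-! ### Lower bound. -/

section LowerBound

variable {k G : Type u} [Field k] [CommGroup G] [Fintype G] {g : G}
  (hg : ∀ x, x ∈ Subgroup.zpowers g) {p r : ℕ} (hp : p.Prime) [CharP k p]
  (hG : Nat.card G = p ^ r)

include hg hp hG

lemma isZero_tateCohomology_translation (V : Type u) [AddCommGroup V] [Module k V] (n : ℤ) :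
    Limits.IsZero (tateCohomology (Rep.of (translation k G V)) n) := by
  have hpos : 0 < p ^ r := Nat.pow_pos hp.pos
  refine isZero_tateCohomology hg _ (fun v hv ↦ mem_range_norm_translation hg v hv) (fun v hv ↦ ?_) n
  rw [norm_eq_subOne_pow _ hg hp hG] at hv
  obtain ⟨w, hw⟩ := exists_subOne_pow_translation hg hp hG (p ^ r - 1) v hv
  rw [Nat.sub_sub_self hpos, pow_one] at hw
  exact ⟨w, hw⟩

lemma exists_isGhostComposite_subOne_pow (M : Rep.{u} k G) [hM : Module.Finite k M] (l : ℕ) :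
    ∃ f : M ⟶ M, IsGhostComposite l f ∧ ∀ m, f.hom m = (subOne M.ρ g ^ l) m := by
  induction l with
  | zero => exact ⟨𝟙 M, .id M hM, fun m ↦ rfl⟩
  | succ l ih =>
    obtain ⟨f, hf, h⟩ := ih
    refine ⟨f ≫ (M.applyAsHom g - 𝟙 M), .comp _ _ hM hf (isGhost_applyAsHom_sub_id
      (fun M n ↦ isZero_tateCohomology_translation hg hp hG M n) M), fun m ↦ ?_⟩
    rw [pow_succ', Module.End.mul_apply, ← h]
    rfl

omit hg hp hG [Fintype G] [CharP k p] in
/-- The kernel of `(g - 1) ^ n` in a representation of a commutative group. -/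
def kerSubOnePow (M : Rep.{u} k G) (g : G) (n : ℕ) : Subrepresentation M.ρ where
  toSubmodule := LinearMap.ker (subOne M.ρ g ^ n)
  apply_mem_toSubmodule h m hm := by
    rw [LinearMap.mem_ker] at hm ⊢
    have := hom_subOne_pow (M.applyAsHom h) g n m
    rw [hm, map_zero] at this
    exact this.symm

omit hg hp hG [Fintype G] [CharP k p] in
lemma coe_subOne_pow_kerSubOnePow (M : Rep.{u} k G) (n i : ℕ)
    (m : (kerSubOnePow M g n).toSubmodule) :
    (((subOne (kerSubOnePow M g n).toRepresentation g ^ i) m : (kerSubOnePow M g n).toSubmodule) :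
      M.V) = (subOne M.ρ g ^ i) m.1 := by
  let ι : Rep.of (kerSubOnePow M g n).toRepresentation ⟶ M :=
    Rep.ofHom ⟨(kerSubOnePow M g n).toSubmodule.subtype, fun h ↦ rfl⟩
  exact hom_subOne_pow ι g i m

lemma exists_isGhostComposite_not_isStablyTrivial {l : ℕ} (hl : l < p ^ r / 2) :
    ∃ (M : Rep.{u} k G) (f : M ⟶ M), IsGhostComposite l f ∧ ¬ IsStablyTrivial f := by
  classical
  let J : Rep.{u} k G := Rep.of (translation k G k)
  have hJ : Module.Finite k J := inferInstanceAs (Module.Finite k (G → k))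
  set n := p ^ r / 2
  let K := kerSubOnePow J g n
  let M : Rep.{u} k G := Rep.of K.toRepresentation
  have hM : Module.Finite k M := inferInstanceAs (Module.Finite k K.toSubmodule)
  obtain ⟨f, hf, hfl⟩ := exists_isGhostComposite_subOne_pow hg hp hG M l
  refine ⟨M, f, hf, fun hst ↦ ?_⟩
  -- `x ^ (q - n) e` generates the Jordan block `M` of length `n`.
  let e : J := Pi.single 1 1
  have he : (subOne J.ρ g ^ (p ^ r - n)) e ∈ K.toSubmodule := by
    change (subOne J.ρ g ^ n) _ = 0
    rw [← pow_apply_add, show n + (p ^ r - n) = p ^ r by omega, subOne_pow_prime_pow _ hp hG,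
      LinearMap.zero_apply]
  let w : M := ⟨_, he⟩
  have hker (w : M) : (subOne M.ρ g ^ n) w = 0 :=
    Subtype.ext ((coe_subOne_pow_kerSubOnePow J n n w).trans w.2)
  obtain ⟨t, ht⟩ := hst.exists_subOne_pow hg hp hG n w (hker w)
  -- As `n ≤ q - n`, `x ^ (q - n)` vanishes on `M`, so `x ^ l w = 0`.
  rw [pow_apply_eq_zero_of_le (by omega) (hker t), hfl] at ht
  have h0 : (subOne J.ρ g ^ l) ((subOne J.ρ g ^ (p ^ r - n)) e) = 0 := by
    have := coe_subOne_pow_kerSubOnePow J n l w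
    exact this.symm.trans (congr_arg Subtype.val ht.symm)
  rw [← pow_apply_add] at h0
  -- Since `l < n`, this forces the norm of `e` to vanish, although its value is the constant `1`.
  have h1 := pow_apply_eq_zero_of_le (j := p ^ r - 1) (by omega) h0
  rw [← norm_eq_subOne_pow _ hg hp hG] at h1
  have h2 : (translation k G k).norm e 1 = 0 := congr_fun h1 1
  rw [norm_translation_apply] at h2
  simp [e] at h2

end LowerBound

lemma ceil_pow_sub_one_div_two {q : ℕ} (hq : 0 < q) : ⌈((q : ℚ) - 1) / 2⌉₊ = q / 2 := by
  obtain ⟨a, rfl | rfl⟩ := Nat.even_or_odd' q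
  · rw [Nat.mul_div_cancel_left a two_pos, Nat.ceil_eq_iff (by omega)]
    have : (1 : ℚ) ≤ a := by exact_mod_cast (by omega : 1 ≤ a)
    push_cast [Nat.cast_sub (by omega : 1 ≤ a)]
    constructor <;> linarith
  · rw [show (2 * a + 1) / 2 = a by omega]
    push_cast
    rw [add_sub_cancel_right, mul_div_cancel_left₀ _ two_ne_zero, Nat.ceil_natCast]

lemma isGhostNumber_of_forall_mem_zpowers {k G : Type u} [Field k] [CommGroup G] [Fintype G] {g : G}
    (hg : ∀ x, x ∈ Subgroup.zpowers g) {p r : ℕ} (hp : p.Prime) [CharP k p]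
    (hG : Nat.card G = p ^ r) : IsGhostNumber k G (p ^ r / 2) := by
  refine ⟨fun M N f hf ↦ hf.isStablyTrivial hg hp hG, fun l hl ↦ ?_⟩
  by_contra! hlt
  obtain ⟨M, f, hf, hst⟩ := exists_isGhostComposite_not_isStablyTrivial (k := k) hg hp hG hlt
  exact hst (hl M M f hf)

end GhostNumber

theorem mainTheorem1 {k G : Type u} [Field k] [Group G] [Fintype G] [IsCyclic G]
    (p r : ℕ) (hp : p.Prime) (hk : CharP k p) (hG : Nat.card G = p ^ r) :
    GhostNumber.IsGhostNumber k G ⌈((p : ℚ) ^ r - 1) / 2⌉₊ := by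
  obtain ⟨g, hg⟩ := IsCyclic.exists_generator (α := G)
  -- Commutativity makes `g - 1` a morphism of representations.
  let _ : CommGroup G := IsCyclic.commGroup
  rw [← Nat.cast_pow, GhostNumber.ceil_pow_sub_one_div_two (Nat.pow_pos hp.pos)]
  exact GhostNumber.isGhostNumber_of_forall_mem_zpowers hg hp hG
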